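/- For $d\ge 2$, $t\ge 0$, a natural number $n$ and a $d$-dimensional quantum state $\kappa$ (a positive semidefinite $d\times d$ complex matrix of unit trace), let $\mathcal{U}_{\kappa,t}(\rho)=e^{-i\kappa t}\rho\, e^{i\kappa t}$ be the unitary evolution generated by $\kappa$, and let $\mathcal{A}_{\kappa^{\otimes n}}(\zeta)=\zeta\otimes\kappa^{\otimes n}$ be the channel that appends $n$ copies of $\kappa$ to its input. The sample complexity $n_d^*(t,\varepsilon)$ of sample-based Hamiltonian simulation is the minimum number $n$ for which there is a quantum channel (completely positive trace-preserving map) $\mathcal{P}^{(n)}$ from $(\mathbb{C}^d)\otimes(\mathbb{C}^d)^{\otimes n}$ to $\mathbb{C}^d$, not depending on $\kappa$, such that $$\tfrac12\left\|\mathcal{P}^{(n)}\circ\mathcal{A}_{\kappa^{\otimes n}}-\mathcal{U}_{\kappa,t}\right\|_\diamond\le\varepsilon\quad\text{for every } d\text{-dimensional state }\kappa ,$$ where $\tfrac12\|\mathcal{N}-\mathcal{M}\|_\diamond=\tfrac12\sup_\rho\|(\mathcal{I}_R\otimes\mathcal{N})(\rho)-(\mathcal{I}_R\otimes\mathcal{M})(\rho)\|_1$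 is the normalized diamond distance, the supremum being over reference systems $R$ of arbitrary finite dimension and all joint input states $\rho$. Theorem. For all $t\ge 0$, all $\varepsilon$ with $0<\varepsilon<\min\left\{\frac{9t}{100\pi},\frac1{10}\right\}$ and all integers $d\ge 2$, $$n_d^*(t,\varepsilon)\;\ge\;\frac{32}{1000}\left(\frac{t^2}{\varepsilon}\right).$$ -/

import Mathlib

open scoped Kronecker ENNReal ComplexOrder

namespace SampleSim

noncomputable section

/-- A quantum state (density matrix): a positive semidefinite matrix of unit trace. -/
def IsState {ι : Type*} [Fintype ι] (ρ : Matrix ι ι ℂ) : Prop :=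
  ρ.PosSemidef ∧ ρ.trace = 1

/-- The trace norm `‖X‖₁ = Tr[(X Xᴴ)^{1/2}]`, with the square root of the positive semidefinite
matrix `X Xᴴ` taken in the functional calculus. -/
def traceNorm {ι : Type*} [Fintype ι] [DecidableEq ι] (X : Matrix ι ι ℂ) : ℝ :=
  (cfc Real.sqrt (X * X.conjTranspose)).trace.re

/-- `(I_R ⊗ Φ)(X)`, for a linear map `Φ` from operators on `α` to operators on `β`, and an operator
`X` on the composite system `R ⊗ α`: the map `Φ` acts on every `α`-block of `X`. -/
def idTensor (R : Type*) {α β : Type*} (Φ : Matrix α α ℂ →ₗ[ℂ] Matrix β β ℂ)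
    (X : Matrix (R × α) (R × α) ℂ) : Matrix (R × β) (R × β) ℂ :=
  Matrix.of fun i j => Φ (Matrix.of fun p q => X (i.1, p) (j.1, q)) i.2 j.2

/-- A quantum channel: a completely positive and trace-preserving linear map. -/
structure IsCPTP {α β : Type*} [Fintype α] [Fintype β]
    (Φ : Matrix α α ℂ →ₗ[ℂ] Matrix β β ℂ) : Prop where
  completelyPositive : ∀ (k : ℕ) (X : Matrix (Fin k × α) (Fin k × α) ℂ),
    X.PosSemidef → (idTensor (Fin k) Φ X).PosSemidef
  tracePreserving : ∀ X : Matrix α α ℂ, (Φ X).trace = X.trace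

/-- The normalized diamond distance `(1/2) ‖Φ - Ψ‖_⋄`: the supremum of the normalized trace distance
of the outputs over all finite dimensions `k` of the reference system and all joint input states.
It takes values in `[0, ∞]`, so that the supremum always exists. -/
def diamondDist {α β : Type*} [Fintype α] [Fintype β] [DecidableEq β]
    (Φ Ψ : Matrix α α ℂ →ₗ[ℂ] Matrix β β ℂ) : ℝ≥0∞ :=
  ⨆ (k : ℕ) (ρ : Matrix (Fin k × α) (Fin k × α) ℂ) (_ : IsState ρ),
    ENNReal.ofReal (1 / 2 * traceNorm (idTensor (Fin k) Φ ρ - idTensor (Fin k) Ψ ρ))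

/-- The tensor power `κ^{⊗ n}`, an operator on `n` copies of the system `α`. -/
def tensorPower {α : Type*} (κ : Matrix α α ℂ) (n : ℕ) :
    Matrix (Fin n → α) (Fin n → α) ℂ :=
  Matrix.of fun i j => ∏ k, κ (i k) (j k)

/-- The appending channel `ζ ↦ ζ ⊗ κ^{⊗ n}`. -/
def appendCopies {α : Type*} (κ : Matrix α α ℂ) (n : ℕ) :
    Matrix α α ℂ →ₗ[ℂ] Matrix (α × (Fin n → α)) (α × (Fin n → α)) ℂ where
  toFun ζ := ζ ⊗ₖ tensorPower κ n
  map_add' ζ ξ := Matrix.add_kronecker ζ ξ _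
  map_smul' c ζ := Matrix.smul_kronecker c ζ _

/-- The ideal evolution `𝒰_{κ,t}(ρ) = e^{-iκt} ρ e^{iκt}` generated by the Hamiltonian `κ`. -/
def evolution {α : Type*} [Fintype α] [DecidableEq α] (κ : Matrix α α ℂ) (t : ℝ) :
    Matrix α α ℂ →ₗ[ℂ] Matrix α α ℂ where
  toFun ρ := NormedSpace.exp ((-(Complex.I * t)) • κ) * ρ * NormedSpace.exp ((Complex.I * t) • κ)
  map_add' ρ ξ := by rw [mul_add, add_mul]
  map_smul' c ρ := by simp

/-- The channel `P`, which acts on the input system and `n` program systems, all of dimension `d`,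
simulates `𝒰_{κ,t}` to within `ε` in normalized diamond distance, for all program states `κ`. -/
def Simulates {d n : ℕ} (t ε : ℝ)
    (P : Matrix (Fin d × (Fin n → Fin d)) (Fin d × (Fin n → Fin d)) ℂ →ₗ[ℂ]
      Matrix (Fin d) (Fin d) ℂ) : Prop :=
  ∀ κ : Matrix (Fin d) (Fin d) ℂ, IsState κ →
    diamondDist (P ∘ₗ appendCopies κ n) (evolution κ t) ≤ ENNReal.ofReal ε

/-- The sample complexity `n_d^*(t, ε)` of sample-based Hamiltonian simulation: the least number `n`
of copies of the program state for which some quantum channel, independent of the program state,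
simulates the ideal evolution to within `ε` (and `∞` if there is no such `n`). -/
def sampleComplexity (d : ℕ) (t ε : ℝ) : ℕ∞ :=
  ⨅ (n : ℕ) (_ : ∃ P : Matrix (Fin d × (Fin n → Fin d)) (Fin d × (Fin n → Fin d)) ℂ →ₗ[ℂ]
      Matrix (Fin d) (Fin d) ℂ, IsCPTP P ∧ Simulates t ε P), (n : ℕ∞)

end

end SampleSim

open scoped Kronecker ENNReal ComplexOrder

namespace SampleSim

noncomputable section

/-! ### Effects and the trace norm -/

/-! The proof amplifies a small difference between two program states by reusing the simulator. Take
the diagonal states with eigenvalues `(1 ± δ) / 2` on two levels, in the two possible orders, and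
feed in an equal superposition of these levels. The ideal evolutions for time `m t` leave it in
orthogonal states when `m t δ = π / 2`. Composing the simulator `m` times costs error at most `m ε`
(`IsEffect.abs_re_iterate_sub_le`), so one measurement tells the two outputs apart with bias at
least `1 - 2 m ε`.

These outputs come from a common input and `n m` program copies, so they cannot be more
distinguishable than the copies, whose squared fidelity is `(1 - δ²) ^ (n m)`. Instead of fidelity
and its monotonicity, the proof carries a positive 2 × 2 block operator with the two states on its
diagonal: the trace of its off-diagonal block is the overlap. Complete positivity and trace
preservation keep this certificate valid through each step (`IsCPTP.exists_block_iterate`), and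
`sq_norm_trace_block_le` bounds the overlap by the bias. The outcome is `(1 - δ²) ^ (n m) ≤ 1 - (1 -
2 m ε)²`.

With `e = m ε`, taking logarithms gives, for small `δ`, roughly `n ≥ (4 / π²) e (-log (1 - (1 - 2
e)²)) t² / ε`. Keeping `e` between `1/10` and `1/5` makes the coefficient at least `32/1000`,
corrections in `δ` included (`copies_ge_of_overlap_le`). -/

/-- A linear functional on operators that takes a value between `0` and the trace on every positive
semidefinite operator: the probability of a measurement outcome. -/
def IsEffect {α : Type*} [Fintype α] (f : Matrix α α ℂ →ₗ[ℂ] ℂ) : Prop :=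
  ∀ X : Matrix α α ℂ, X.PosSemidef → 0 ≤ (f X).re ∧ (f X).re ≤ X.trace.re

/-- Both `|D| + D` and `|D| - D` are positive with trace `‖D‖₁`, so `f` takes values in `[0, ‖D‖₁]`
on each; half the difference of these values is `f D`. -/
theorem IsEffect.abs_re_le_traceNorm {α : Type*} [Fintype α] [DecidableEq α]
    {f : Matrix α α ℂ →ₗ[ℂ] ℂ} (hf : IsEffect f) {D : Matrix α α ℂ} (hD : D.IsHermitian)
    (htr : D.trace = 0) : |(f D).re| ≤ 1 / 2 * traceNorm D := by
  have hsa : IsSelfAdjoint D := hD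
  set A : Matrix α α ℂ := cfc Real.sqrt (D * D.conjTranspose) with hA
  have habs : A = cfc (fun x : ℝ => |x|) D := by
    have h2 : D * D.conjTranspose = cfc (fun x : ℝ => x ^ 2) D := by
      rw [cfc_pow_id (R := ℝ) D 2, hD.eq, sq]
    rw [hA, h2, ← cfc_comp Real.sqrt (fun x : ℝ => x ^ 2) D]
    congr 1
    funext x
    exact Real.sqrt_sq_eq_abs x
  have hplus : (A + D).PosSemidef := by
    have h : A + D = cfc (fun x : ℝ => |x| + x) D := by
      rw [habs, cfc_add D (fun x : ℝ => |x|) (fun x : ℝ => x), cfc_id' ℝ D]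
    rw [h]
    open scoped MatrixOrder in
    exact Matrix.nonneg_iff_posSemidef.mp
      (cfc_nonneg fun x _ => by linarith [neg_abs_le x])
  have hminus : (A - D).PosSemidef := by
    have h : A - D = cfc (fun x : ℝ => |x| - x) D := by
      rw [habs, cfc_sub (fun x : ℝ => |x|) (fun x : ℝ => x) D, cfc_id' ℝ D]
    rw [h]
    open scoped MatrixOrder in
    exact Matrix.nonneg_iff_posSemidef.mp
      (cfc_nonneg fun x _ => by linarith [le_abs_self x])
  have h1 := hf _ hplus
  have h2 := hf _ hminus
  simp only [map_add, map_sub, Matrix.trace_add, Matrix.trace_sub, htr, add_zero, sub_zero,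
    Complex.add_re, Complex.sub_re] at h1 h2
  have h3 : traceNorm D = A.trace.re := rfl
  rw [h3, abs_le]
  constructor <;> linarith [h1.1, h1.2, h2.1, h2.2]

/-! ### Blocks of operators on composite systems -/

/-- The block of an operator on `κ × α` at a pair of indices of the first factor. -/
def block {κ α : Type*} (W : Matrix (κ × α) (κ × α) ℂ) (a b : κ) : Matrix α α ℂ :=
  W.submatrix (Prod.mk a) (Prod.mk b)

theorem block_idTensor {κ α β : Type*} (Φ : Matrix α α ℂ →ₗ[ℂ] Matrix β β ℂ)
    (W : Matrix (κ × α) (κ × α) ℂ) (a b : κ) : block (idTensor κ Φ W) a b = Φ (block W a b) :=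
  rfl

theorem block_posSemidef {κ α : Type*} {W : Matrix (κ × α) (κ × α) ℂ}
    (hW : W.PosSemidef) (a : κ) : (block W a a).PosSemidef :=
  hW.submatrix _

/-- The operator whose blocks are the tensor products of the blocks of two operators. -/
def blockProduct {κ α β : Type*} (W : Matrix (κ × α) (κ × α) ℂ) (Y : Matrix (κ × β) (κ × β) ℂ) :
    Matrix (κ × α × β) (κ × α × β) ℂ :=
  (W ⊗ₖ Y).submatrix (fun x => ((x.1, x.2.1), (x.1, x.2.2))) fun x => ((x.1, x.2.1), (x.1, x.2.2))

theorem block_blockProduct {κ α β : Type*} (W : Matrix (κ × α) (κ × α) ℂ)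
    (Y : Matrix (κ × β) (κ × β) ℂ) (a b : κ) :
    block (blockProduct W Y) a b = block W a b ⊗ₖ block Y a b :=
  rfl

theorem blockProduct_posSemidef {κ α β : Type*} [Fintype κ] [Fintype α] [Fintype β]
    {W : Matrix (κ × α) (κ × α) ℂ} {Y : Matrix (κ × β) (κ × β) ℂ} (hW : W.PosSemidef)
    (hY : Y.PosSemidef) : (blockProduct W Y).PosSemidef :=
  (hW.kronecker hY).submatrix _

theorem IsCPTP.posSemidef {α β : Type*} [Fintype α] [Fintype β]
    {Φ : Matrix α α ℂ →ₗ[ℂ] Matrix β β ℂ} (hΦ : IsCPTP Φ) {X : Matrix α α ℂ}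
    (hX : X.PosSemidef) : (Φ X).PosSemidef :=
  block_posSemidef (hΦ.completelyPositive 1 (X.submatrix Prod.snd Prod.snd) (hX.submatrix _)) 0

/-- A positive and trace-preserving map. -/
def IsPTP {α β : Type*} [Fintype α] [Fintype β] (Φ : Matrix α α ℂ →ₗ[ℂ] Matrix β β ℂ) : Prop :=
  ∀ X : Matrix α α ℂ, X.PosSemidef → (Φ X).PosSemidef ∧ (Φ X).trace = X.trace

theorem IsEffect.comp {α β : Type*} [Fintype α] [Fintype β] {f : Matrix β β ℂ →ₗ[ℂ] ℂ}
    (hf : IsEffect f) {Φ : Matrix α α ℂ →ₗ[ℂ] Matrix β β ℂ} (hΦ : IsPTP Φ) :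
    IsEffect (f ∘ₗ Φ) := fun X hX => by
  have h := hf _ (hΦ X hX).1
  rw [(hΦ X hX).2] at h
  exact h

/-- Measurement statistics of the outputs differ by at most the diamond distance. -/
theorem IsEffect.abs_re_sub_le {α : Type*} [Fintype α] [DecidableEq α]
    {Φ Ψ : Matrix α α ℂ →ₗ[ℂ] Matrix α α ℂ} {ε : ℝ} (hε : 0 ≤ ε)
    (h : diamondDist Φ Ψ ≤ ENNReal.ofReal ε) {f : Matrix α α ℂ →ₗ[ℂ] ℂ} (hf : IsEffect f)
    {σ : Matrix α α ℂ} (hσ : IsState σ) (hΦ : IsState (Φ σ)) (hΨ : IsState (Ψ σ)) :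
    |(f (Φ σ) - f (Ψ σ)).re| ≤ ε := by
  -- A trivial one-dimensional reference suffices: the lower bound never uses entangled inputs.
  set ρ : Matrix (Fin 1 × α) (Fin 1 × α) ℂ := σ.submatrix Prod.snd Prod.snd with hρ
  have htr : ∀ X : Matrix α α ℂ,
      (X.submatrix Prod.snd Prod.snd : Matrix (Fin 1 × α) (Fin 1 × α) ℂ).trace = X.trace := by
    intro X
    simp [Matrix.trace, Fintype.sum_prod_type]
  have hρs : IsState ρ := ⟨hσ.1.submatrix _, by rw [hρ, htr, hσ.2]⟩
  set D : Matrix (Fin 1 × α) (Fin 1 × α) ℂ := idTensor (Fin 1) Φ ρ - idTensor (Fin 1) Ψ ρ with hD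
  have hDeq : D = (Φ σ - Ψ σ).submatrix Prod.snd Prod.snd := rfl
  have hle : 1 / 2 * traceNorm D ≤ ε := by
    rw [← ENNReal.ofReal_le_ofReal_iff hε]
    refine le_trans ?_ h
    exact le_iSup_of_le 1 (le_iSup_of_le ρ (le_iSup_of_le hρs le_rfl))
  let g : Matrix (Fin 1 × α) (Fin 1 × α) ℂ →ₗ[ℂ] ℂ :=
    { toFun := fun X => f (block X 0 0)
      map_add' := fun X Y => f.map_add (block X 0 0) (block Y 0 0)
      map_smul' := fun c X => f.map_smul c (block X 0 0) }
  have hg : IsEffect g := fun X hX => by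
    have h1 := hf _ (block_posSemidef hX 0)
    have h2 : (block X 0 0).trace = X.trace := by
      simp [Matrix.trace, Fintype.sum_prod_type, block]
    rw [h2] at h1
    exact h1
  have hgD : g D = f (Φ σ) - f (Ψ σ) := by rw [← map_sub]; rfl
  rw [← hgD]
  refine (hg.abs_re_le_traceNorm ?_ ?_).trans hle
  · rw [hDeq]
    exact (hΦ.1.isHermitian.sub hΨ.1.isHermitian).submatrix _
  · rw [hDeq, htr, Matrix.trace_sub, hΦ.2, hΨ.2, sub_self]

/-- The errors of repeated uses of a simulating map add up. -/
theorem IsEffect.abs_re_iterate_sub_le {α : Type*} [Fintype α] [DecidableEq α]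
    {Φ Ψ : Matrix α α ℂ →ₗ[ℂ] Matrix α α ℂ} {ε : ℝ} (hε : 0 ≤ ε)
    (h : diamondDist Φ Ψ ≤ ENNReal.ofReal ε) (hΦ : IsPTP Φ) {σ : ℕ → Matrix α α ℂ}
    (hσ : ∀ k, IsState (σ k)) (hΨ : ∀ k, Ψ (σ k) = σ (k + 1)) (k : ℕ) :
    ∀ {f : Matrix α α ℂ →ₗ[ℂ] ℂ}, IsEffect f →
      |(f (Φ^[k] (σ 0)) - f (σ k)).re| ≤ k * ε := by
  induction k with
  | zero => intro f _; simp
  | succ k ih =>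
    intro f hf
    -- Hybrid argument: the last use of `Φ` is absorbed into the effect, which is why the induction
    -- hypothesis ranges over all effects.
    have h1 := ih (hf.comp hΦ)
    have hs : IsState (Φ (σ k)) :=
      ⟨(hΦ _ (hσ k).1).1, by rw [(hΦ _ (hσ k).1).2, (hσ k).2]⟩
    have h2 := hf.abs_re_sub_le hε h (hσ k) hs (by rw [hΨ]; exact hσ _)
    rw [hΨ] at h2
    rw [Function.iterate_succ_apply']
    simp only [LinearMap.comp_apply, Complex.sub_re] at h1 h2 ⊢
    rw [abs_le] at *
    push_cast
    constructor <;> linarith [h1.1, h1.2, h2.1, h2.2]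

/-! ### Overlap of the two states certified by a positive block operator -/

/-- Compressing `W` by `1 ⊗ C` and tracing out `α` leaves a positive 2 × 2 matrix; the inequality is
nonnegativity of its determinant. -/
theorem effect_block_sq_norm_le {α : Type*} [Fintype α] [DecidableEq α]
    {W : Matrix (Fin 2 × α) (Fin 2 × α) ℂ} (hW : W.PosSemidef) (C : Matrix α α ℂ) :
    ‖(C.conjTranspose * C * block W 0 1).trace‖ ^ 2 ≤
      (C.conjTranspose * C * block W 0 0).trace.re *
        (C.conjTranspose * C * block W 1 1).trace.re := by
  set Q : Matrix (Fin 2) (Fin 2) ℂ :=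
    Matrix.of fun a b => (C.conjTranspose * C * block W a b).trace with hQ
  have hpos : Q.PosSemidef := by
    have h : Q = ∑ i, (((1 : Matrix (Fin 2) (Fin 2) ℂ) ⊗ₖ C) * W *
        ((1 : Matrix (Fin 2) (Fin 2) ℂ) ⊗ₖ C).conjTranspose).submatrix
          (fun a => (a, i)) (fun a => (a, i)) := by
      ext a b
      rw [hQ, Matrix.of_apply, Matrix.mul_assoc, Matrix.trace_mul_comm]
      simp only [Matrix.sum_apply, Matrix.trace, Matrix.diag, Matrix.submatrix_apply]
      refine Finset.sum_congr rfl fun i _ => ?_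
      simp [Matrix.mul_apply, Fintype.sum_prod_type, Matrix.one_apply, block,
        Finset.sum_ite_eq]
      fin_cases a <;> fin_cases b <;> simp
    rw [h]
    exact Matrix.posSemidef_sum _ fun i _ =>
      (hW.mul_mul_conjTranspose_same _).submatrix _
  have hdet := hpos.det_nonneg
  have h10 : Q 1 0 = star (Q 0 1) := (hpos.isHermitian.apply 1 0).symm
  have h00 : (Q 0 0).im = 0 := by
    have := hpos.diag_nonneg (i := 0)
    exact (Complex.nonneg_iff.mp this).2.symm
  have h11 : (Q 1 1).im = 0 := by
    have := hpos.diag_nonneg (i := 1)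
    exact (Complex.nonneg_iff.mp this).2.symm
  rw [Matrix.det_fin_two, h10] at hdet
  have hre := (Complex.nonneg_iff.mp hdet).1
  simp only [Complex.sub_re, Complex.mul_re, h00, h11, Complex.star_def, Complex.conj_re,
    Complex.conj_im] at hre
  change ‖Q 0 1‖ ^ 2 ≤ (Q 0 0).re * (Q 1 1).re
  rw [← Complex.normSq_eq_norm_sq, Complex.normSq_apply]
  linarith

/-- The probability of finding a state in the direction of `v`. -/
def projFunctional {α : Type*} [Fintype α] [DecidableEq α] (v : α → ℂ) :
    Matrix α α ℂ →ₗ[ℂ] ℂ :=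
  Matrix.traceLinearMap α ℂ ℂ ∘ₗ LinearMap.mulLeft ℂ (Matrix.vecMulVec v (star v))

theorem projFunctional_apply {α : Type*} [Fintype α] [DecidableEq α] (v : α → ℂ)
    (X : Matrix α α ℂ) :
    projFunctional v X = (Matrix.vecMulVec v (star v) * X).trace := rfl

theorem projFunctional_vecMulVec {α : Type*} [Fintype α] [DecidableEq α] (v w : α → ℂ) :
    projFunctional v (Matrix.vecMulVec w (star w)) = (star v ⬝ᵥ w) * (star w ⬝ᵥ v) := by
  rw [projFunctional_apply, Matrix.vecMulVec_mul_vecMulVec, Matrix.trace_vecMulVec,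
    dotProduct_smul, smul_eq_mul, dotProduct_comm v]

theorem vecMulVec_conjTranspose_mul_self {α : Type*} [Fintype α] {v : α → ℂ}
    (hv : star v ⬝ᵥ v = 1) :
    (Matrix.vecMulVec v (star v)).conjTranspose * Matrix.vecMulVec v (star v) =
      Matrix.vecMulVec v (star v) := by
  rw [Matrix.conjTranspose_vecMulVec, star_star, Matrix.vecMulVec_mul_vecMulVec, hv, one_smul]

theorem one_sub_vecMulVec_conjTranspose_mul_self {α : Type*} [Fintype α] [DecidableEq α]
    {v : α → ℂ} (hv : star v ⬝ᵥ v = 1) :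
    (1 - Matrix.vecMulVec v (star v)).conjTranspose * (1 - Matrix.vecMulVec v (star v)) =
      1 - Matrix.vecMulVec v (star v) := by
  have h := vecMulVec_conjTranspose_mul_self hv
  have h2 : (Matrix.vecMulVec v (star v)).conjTranspose = Matrix.vecMulVec v (star v) := by
    rw [Matrix.conjTranspose_vecMulVec, star_star]
  rw [h2] at h
  rw [Matrix.conjTranspose_sub, Matrix.conjTranspose_one, h2, mul_sub, sub_mul, sub_mul, h]
  simp

theorem projFunctional_isEffect {α : Type*} [Fintype α] [DecidableEq α] {v : α → ℂ}
    (hv : star v ⬝ᵥ v = 1) : IsEffect (projFunctional v) := fun X hX => by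
  have key : ∀ C : Matrix α α ℂ, 0 ≤ (C.conjTranspose * C * X).trace.re := fun C => by
    rw [Matrix.mul_assoc, Matrix.trace_mul_comm]
    exact (Complex.nonneg_iff.mp (hX.mul_mul_conjTranspose_same C).trace_nonneg).1
  have h1 := key (Matrix.vecMulVec v (star v))
  have h2 := key (1 - Matrix.vecMulVec v (star v))
  rw [vecMulVec_conjTranspose_mul_self hv] at h1
  rw [one_sub_vecMulVec_conjTranspose_mul_self hv, sub_mul, one_mul, Matrix.trace_sub,
    Complex.sub_re] at h2
  rw [projFunctional_apply]
  exact ⟨h1, by linarith⟩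

/-- The Fuchs-van de Graaf type bound for a binary measurement. -/
theorem sq_norm_trace_block_le {α : Type*} [Fintype α] [DecidableEq α]
    {W : Matrix (Fin 2 × α) (Fin 2 × α) ℂ} (hW : W.PosSemidef) {v : α → ℂ}
    (hv : star v ⬝ᵥ v = 1) (h0 : (block W 0 0).trace = 1) (h1 : (block W 1 1).trace = 1) :
    ‖(block W 0 1).trace‖ ^ 2 ≤
      1 - ((projFunctional v (block W 0 0)).re - (projFunctional v (block W 1 1)).re) ^ 2 := by
  have hq := effect_block_sq_norm_le hW (Matrix.vecMulVec v (star v))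
  have hr := effect_block_sq_norm_le hW (1 - Matrix.vecMulVec v (star v))
  have ea := projFunctional_isEffect hv _ (block_posSemidef hW 0)
  have eb := projFunctional_isEffect hv _ (block_posSemidef hW 1)
  rw [vecMulVec_conjTranspose_mul_self hv] at hq
  rw [one_sub_vecMulVec_conjTranspose_mul_self hv] at hr
  simp only [sub_mul, one_mul, Matrix.trace_sub, h0, h1, ← projFunctional_apply,
    Complex.sub_re, Complex.one_re] at hq hr ea eb
  set q := projFunctional v (block W 0 1)
  set a := (projFunctional v (block W 0 0)).re
  set b := (projFunctional v (block W 1 1)).re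
  set T := (block W 0 1).trace
  replace hr : ‖T - q‖ ^ 2 ≤ (1 - a) * (1 - b) := hr.trans_eq (by ring)
  have htri : ‖T‖ ≤ ‖q‖ + ‖T - q‖ := by
    calc ‖T‖ = ‖q + (T - q)‖ := by congr 1; ring
      _ ≤ _ := norm_add_le _ _
  -- AM-GM for `a (1 - a)` and `b (1 - b)`, with the factors of the product regrouped.
  have hprod : 2 * (‖q‖ * ‖T - q‖) ≤ a * (1 - a) + b * (1 - b) := by
    have hx : 0 ≤ a * (1 - a) := mul_nonneg ea.1 (by linarith [ea.2])
    have hy : 0 ≤ b * (1 - b) := mul_nonneg eb.1 (by linarith [eb.2])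
    refine abs_le_of_sq_le_sq' ?_ (by linarith) |>.2
    have hm : ‖q‖ ^ 2 * ‖T - q‖ ^ 2 ≤ (a * b) * ((1 - a) * (1 - b)) :=
      mul_le_mul hq hr (sq_nonneg _) (mul_nonneg ea.1 eb.1)
    nlinarith [sq_nonneg (a * (1 - a) - b * (1 - b))]
  calc ‖T‖ ^ 2 ≤ (‖q‖ + ‖T - q‖) ^ 2 := by gcongr
    _ = ‖q‖ ^ 2 + ‖T - q‖ ^ 2 + 2 * (‖q‖ * ‖T - q‖) := by ring
    _ ≤ a * b + (1 - a) * (1 - b) + (a * (1 - a) + b * (1 - b)) := by gcongr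
    _ = 1 - (a - b) ^ 2 := by ring

/-! ### Simulation with diagonal program states -/

/-- The certificate of the overlap of `n` copies of two diagonal states with eigenvalues
`(s a i) ^ 2`: its blocks are diagonal, with entries the products of amplitudes. -/
def amplitudeGram {α : Type*} [DecidableEq α] (s : Fin 2 → α → ℝ) (n : ℕ) :
    Matrix (Fin 2 × (Fin n → α)) (Fin 2 × (Fin n → α)) ℂ :=
  Matrix.of fun x y => if x.2 = y.2 then ∏ k, ((s x.1 (x.2 k) : ℂ) * s y.1 (y.2 k)) else 0

theorem amplitudeGram_posSemidef {α : Type*} [Fintype α] [DecidableEq α] (s : Fin 2 → α → ℝ)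
    (n : ℕ) : (amplitudeGram s n).PosSemidef := by
  let B : Matrix (Fin n → α) (Fin 2 × (Fin n → α)) ℂ :=
    Matrix.of fun h x => if h = x.2 then ∏ k, (s x.1 (x.2 k) : ℂ) else 0
  have h : amplitudeGram s n = B.conjTranspose * B := by
    ext x y
    rw [Matrix.mul_apply, Finset.sum_eq_single y.2]
    · simp only [amplitudeGram, B, Matrix.of_apply, Matrix.conjTranspose_apply, if_true,
        Finset.prod_mul_distrib]
      by_cases hxy : x.2 = y.2
      · simp [hxy]
      · simp [hxy, Ne.symm hxy]
    · intro h _ hne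
      simp [B, hne]
    · simp
  rw [h]
  exact Matrix.posSemidef_conjTranspose_mul_self B

theorem block_amplitudeGram_self {α : Type*} [DecidableEq α] (s : Fin 2 → α → ℝ) (n : ℕ)
    (a : Fin 2) :
    block (amplitudeGram s n) a a =
      tensorPower (Matrix.diagonal fun i => ((s a i ^ 2 : ℝ) : ℂ)) n := by
  ext f g
  simp only [block, amplitudeGram, tensorPower, Matrix.submatrix_apply, Matrix.of_apply,
    Matrix.diagonal_apply]
  split_ifs with h
  · subst h
    simp [sq]
  · obtain ⟨k, hk⟩ := Function.ne_iff.mp h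
    rw [Finset.prod_eq_zero (Finset.mem_univ k)]
    simp [hk]

theorem trace_block_amplitudeGram {α : Type*} [Fintype α] [DecidableEq α] (s : Fin 2 → α → ℝ)
    (n : ℕ) (a b : Fin 2) :
    (block (amplitudeGram s n) a b).trace = ((∑ i, s a i * s b i : ℝ) : ℂ) ^ n := by
  have h := Finset.prod_univ_sum (fun _ : Fin n => (Finset.univ : Finset α))
    (fun _ i => (s a i : ℂ) * s b i)
  simp only [Finset.prod_const, Finset.card_univ, Fintype.card_fin, Fintype.piFinset_univ] at h
  push_cast
  rw [h]
  simp [Matrix.trace, block, amplitudeGram]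

section Simulation

variable {α : Type*} [Fintype α] [DecidableEq α] {n : ℕ}
  {P : Matrix (α × (Fin n → α)) (α × (Fin n → α)) ℂ →ₗ[ℂ] Matrix α α ℂ}

theorem IsCPTP.isPTP_comp_appendCopies (hP : IsCPTP P) {s : Fin 2 → α → ℝ} {a : Fin 2}
    (hs : ∑ i, s a i ^ 2 = 1) :
    IsPTP (P ∘ₗ appendCopies (Matrix.diagonal fun i => ((s a i ^ 2 : ℝ) : ℂ)) n) := by
  intro X hX
  -- The diagonal blocks of the certificate are the program copies themselves, so their positivity
  -- and trace come from it.
  have h1 := block_posSemidef (amplitudeGram_posSemidef s n) a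
  have h2 := trace_block_amplitudeGram s n a a
  rw [block_amplitudeGram_self] at h1 h2
  refine ⟨hP.posSemidef (hX.kronecker h1), ?_⟩
  refine (hP.tracePreserving _).trans ?_
  refine (Matrix.trace_kronecker _ _).trans ?_
  rw [h2]
  simp [← sq, hs]

/-- Running the simulation `m` times on the same input, with either program state, leaves the
outputs overlapping at least as much as `n * m` copies of the program states. -/
theorem IsCPTP.exists_block_iterate (hP : IsCPTP P) (s : Fin 2 → α → ℝ) {ρ : Matrix α α ℂ}
    (hρ : IsState ρ) (m : ℕ) :
    ∃ W : Matrix (Fin 2 × α) (Fin 2 × α) ℂ, W.PosSemidef ∧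
      (∀ a, block W a a =
        (P ∘ₗ appendCopies (Matrix.diagonal fun i => ((s a i ^ 2 : ℝ) : ℂ)) n)^[m] ρ) ∧
      (block W 0 1).trace = ((∑ i, s 0 i * s 1 i : ℝ) : ℂ) ^ (n * m) := by
  induction m with
  | zero =>
    refine ⟨ρ.submatrix Prod.snd Prod.snd, hρ.1.submatrix _, fun a => rfl, ?_⟩
    rw [mul_zero, pow_zero]
    exact hρ.2
  | succ m ih =>
    obtain ⟨W, hW, hdiag, htr⟩ := ih
    refine ⟨idTensor (Fin 2) P (blockProduct W (amplitudeGram s n)),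
      hP.completelyPositive 2 _ (blockProduct_posSemidef hW (amplitudeGram_posSemidef s n)),
      fun a => ?_, ?_⟩
    · rw [block_idTensor, block_blockProduct, block_amplitudeGram_self, hdiag,
        Function.iterate_succ_apply']
      rfl
    · rw [block_idTensor, block_blockProduct, hP.tracePreserving, Matrix.trace_kronecker, htr,
        trace_block_amplitudeGram, ← pow_add, mul_add, mul_one]

end Simulation

/-! ### The ideal evolution of a superposition -/

/-- The pure state vector with amplitudes `c i` evolved under the diagonal Hamiltonian `h`. -/
def phaseVec {α : Type*} (h c : α → ℝ) (t : ℝ) (i : α) : ℂ :=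
  Complex.exp (-(Complex.I * t) * h i) * c i

theorem evolution_diagonal {α : Type*} [Fintype α] [DecidableEq α] (h c : α → ℝ) (t u : ℝ) :
    evolution (Matrix.diagonal fun i => (h i : ℂ)) t
        (Matrix.vecMulVec (phaseVec h c u) (star (phaseVec h c u))) =
      Matrix.vecMulVec (phaseVec h c (u + t)) (star (phaseVec h c (u + t))) := by
  have hexp : ∀ z : ℂ, NormedSpace.exp (z • Matrix.diagonal fun i => (h i : ℂ)) =
      Matrix.diagonal fun i => Complex.exp (z * h i) := by
    intro z
    rw [← Matrix.diagonal_smul, Matrix.exp_diagonal]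
    congr 1
    funext i
    rw [Pi.coe_exp, Complex.exp_eq_exp_ℂ]
    rfl
  simp only [evolution, LinearMap.coe_mk, AddHom.coe_mk]
  rw [hexp, hexp]
  ext i j
  rw [Matrix.mul_diagonal, Matrix.diagonal_mul]
  simp only [Matrix.vecMulVec_apply, Pi.star_apply, phaseVec, star_mul', Complex.star_def,
    ← Complex.exp_conj, map_mul, map_neg, Complex.conj_I, Complex.conj_ofReal]
  have e1 : Complex.exp (-(Complex.I * ((u + t : ℝ) : ℂ)) * h i) =
      Complex.exp (-(Complex.I * t) * h i) * Complex.exp (-(Complex.I * u) * h i) := by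
    rw [← Complex.exp_add]; push_cast; ring_nf
  have e2 : Complex.exp (-(-Complex.I * ((u + t : ℝ) : ℂ)) * h j) =
      Complex.exp (-(-Complex.I * u) * h j) * Complex.exp (Complex.I * t * h j) := by
    rw [← Complex.exp_add]; push_cast; ring_nf
  rw [e1, e2]
  ring

theorem star_phaseVec_dotProduct {α : Type*} [Fintype α] (h h' c : α → ℝ) (t : ℝ) :
    star (phaseVec h c t) ⬝ᵥ phaseVec h' c t =
      ∑ i, Complex.exp (Complex.I * t * (h i - h' i)) * (c i ^ 2 : ℝ) := by
  refine Finset.sum_congr rfl fun i _ => ?_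
  simp only [Pi.star_apply, phaseVec, star_mul', Complex.star_def,
    ← Complex.exp_conj, map_mul, map_neg, Complex.conj_I, Complex.conj_ofReal]
  have e1 : Complex.exp (Complex.I * t * (h i - h' i)) =
      Complex.exp (-(-Complex.I * t) * h i) * Complex.exp (-(Complex.I * t) * h' i) := by
    rw [← Complex.exp_add]; ring_nf
  rw [e1]
  push_cast
  ring

theorem star_phaseVec_dotProduct_self {α : Type*} [Fintype α] {h c : α → ℝ} {t : ℝ}
    (hc : ∑ i, c i ^ 2 = 1) : star (phaseVec h c t) ⬝ᵥ phaseVec h c t = 1 := by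
  rw [star_phaseVec_dotProduct]
  simp only [sub_self, mul_zero, Complex.exp_zero, one_mul]
  exact_mod_cast hc

theorem isState_vecMulVec {α : Type*} [Fintype α] {v : α → ℂ}
    (hv : star v ⬝ᵥ v = 1) : IsState (Matrix.vecMulVec v (star v)) :=
  ⟨Matrix.posSemidef_vecMulVec_self_star v, by rw [Matrix.trace_vecMulVec, dotProduct_comm, hv]⟩

/-- If the ideal evolutions generated by two diagonal states become orthogonal after `m` steps,
then the total error of `m` simulation steps bounds the overlap of the program states. -/
theorem overlap_pow_le_of_simulates {d n : ℕ} {t ε : ℝ} (hε : 0 ≤ ε)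
    {P : Matrix (Fin d × (Fin n → Fin d)) (Fin d × (Fin n → Fin d)) ℂ →ₗ[ℂ]
      Matrix (Fin d) (Fin d) ℂ} (hP : IsCPTP P) (hsim : Simulates t ε P)
    {s : Fin 2 → Fin d → ℝ} (hs : ∀ a, ∑ i, s a i ^ 2 = 1) {c : Fin d → ℝ}
    (hc : ∑ i, c i ^ 2 = 1) {m : ℕ} (hm : m * ε ≤ 1 / 2)
    (horth : star (phaseVec (fun i => s 0 i ^ 2) c (m * t)) ⬝ᵥ
      phaseVec (fun i => s 1 i ^ 2) c (m * t) = 0) :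
    ((∑ i, s 0 i * s 1 i) ^ (n * m)) ^ 2 ≤ 1 - (1 - 2 * (m * ε)) ^ 2 := by
  set ψ : Fin 2 → ℕ → Fin d → ℂ := fun a k => phaseVec (fun i => s a i ^ 2) c (k * t) with hψ
  have hunit : ∀ a k, star (ψ a k) ⬝ᵥ ψ a k = 1 := fun a k => star_phaseVec_dotProduct_self hc
  set ρ : Fin 2 → ℕ → Matrix (Fin d) (Fin d) ℂ :=
    fun a k => Matrix.vecMulVec (ψ a k) (star (ψ a k)) with hρ
  have hstate : ∀ a k, IsState (ρ a k) := fun a k => isState_vecMulVec (hunit a k)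
  have hψ0 : ψ 1 0 = ψ 0 0 := by
    funext i
    simp [hψ, phaseVec]
  have hinit : ∀ a, ρ a 0 = ρ 0 0 := by
    intro a
    fin_cases a
    · rfl
    · simp [hρ, hψ0]
  have hstep : ∀ a k, evolution (Matrix.diagonal fun i => ((s a i ^ 2 : ℝ) : ℂ)) t (ρ a k) =
      ρ a (k + 1) := by
    intro a k
    simp only [hρ, hψ]
    rw [evolution_diagonal]
    push_cast
    rw [add_mul, one_mul]
  have hκ : ∀ a, IsState (Matrix.diagonal fun i => ((s a i ^ 2 : ℝ) : ℂ)) := by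
    intro a
    refine ⟨Matrix.PosSemidef.diagonal fun i => ?_, ?_⟩
    · exact Complex.zero_le_real.mpr (sq_nonneg _)
    · rw [Matrix.trace_diagonal]
      exact_mod_cast hs a
  obtain ⟨W, hW, hdiag, htr⟩ := hP.exists_block_iterate s (hstate 0 0) m
  have hPTP := fun a => hP.isPTP_comp_appendCopies (s := s) (hs a)
  have htrace : ∀ a, (block W a a).trace = 1 := by
    intro a
    have : ∀ k, IsState
        ((P ∘ₗ appendCopies (Matrix.diagonal fun i => ((s a i ^ 2 : ℝ) : ℂ)) n)^[k] (ρ 0 0)) := by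
      intro k
      induction k with
      | zero => exact hstate 0 0
      | succ k ih =>
        rw [Function.iterate_succ_apply']
        exact ⟨(hPTP a _ ih.1).1, by rw [(hPTP a _ ih.1).2, ih.2]⟩
    rw [hdiag]
    exact (this m).2
  have herr : ∀ a, |(projFunctional (ψ 0 m) (block W a a) -
      projFunctional (ψ 0 m) (ρ a m)).re| ≤ m * ε := by
    intro a
    have h := IsEffect.abs_re_iterate_sub_le hε (hsim _ (hκ a)) (hPTP a) (hstate a) (hstep a) m
      (projFunctional_isEffect (hunit 0 m))
    rwa [hinit a, ← hdiag] at h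
  have h0 := herr 0
  have h1 := herr 1
  have horth' : star (ψ 0 m) ⬝ᵥ ψ 1 m = 0 := horth
  simp only [hρ, projFunctional_vecMulVec, hunit, horth', mul_one, zero_mul, sub_zero,
    Complex.sub_re, Complex.one_re] at h0 h1
  have hfid := sq_norm_trace_block_le hW (hunit 0 m) (htrace 0) (htrace 1)
  rw [htr, ← Complex.ofReal_pow, Complex.norm_real, Real.norm_eq_abs, sq_abs] at hfid
  refine hfid.trans ?_
  have hgap : 1 - 2 * (m * ε) ≤ (projFunctional (ψ 0 m) (block W 0 0)).re -
      (projFunctional (ψ 0 m) (block W 1 1)).re := by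
    linarith [(abs_le.mp h0).1, (abs_le.mp h1).2]
  have := pow_le_pow_left₀ (by linarith) hgap 2
  linarith

/-! ### Numerical estimates -/

/-- The first three terms of the logarithm series, all of whose terms are nonnegative. -/
theorem le_neg_log_one_sub {x : ℝ} (hx : 0 ≤ x) (hx1 : x < 1) :
    x + x ^ 2 / 2 + x ^ 3 / 3 ≤ -Real.log (1 - x) := by
  have h := Real.hasSum_pow_div_log_of_abs_lt_one (by rwa [abs_of_nonneg hx])
  have := sum_le_hasSum (Finset.range 3) (fun i _ => by positivity) h
  norm_num [Finset.sum_range_succ] at this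
  linarith

/-- From the quadratic term on, the logarithm series is dominated by a geometric series with first
term `y² / 2`. -/
theorem neg_log_one_sub_le {y : ℝ} (hy : 0 ≤ y) (hy1 : y < 1) :
    -Real.log (1 - y) ≤ y * (1 - y / 2) / (1 - y) := by
  have h := Real.hasSum_pow_div_log_of_abs_lt_one (by rwa [abs_of_nonneg hy])
  have hg := (hasSum_geometric_of_lt_one hy hy1).mul_left (y ^ 2 / 2)
  have h0 : HasSum (fun n : ℕ => y ^ (n + 1 + 1) / ((n + 1 : ℕ) + 1 : ℝ)) (-Real.log (1 - y) - y) := by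
    have := (hasSum_nat_add_iff' 1).mpr h
    simpa using this
  have := hasSum_le (fun n => ?_) h0 hg
  · have h2 : y * (1 - y / 2) / (1 - y) = y + y ^ 2 / 2 * (1 - y)⁻¹ := by
      have : 1 - y ≠ 0 := by linarith
      field_simp
      ring
    linarith
  · have : y ^ (n + 1 + 1) / ((n + 1 : ℕ) + 1 : ℝ) ≤ y ^ (n + 1 + 1) / 2 := by
      gcongr
      push_cast
      linarith [(Nat.cast_nonneg n : (0 : ℝ) ≤ n)]
    refine this.trans_eq ?_
    ring

/-- The overlap of `n * m` copies of states with Bloch vectors `±δ` bounds `n` from below, when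
`m` uses of the simulation amplify the phase `δ t` to `π / 2` with total error `m ε`. -/
theorem copies_ge_of_overlap_le {t ε δ e : ℝ} {n m : ℕ} (ht : 0 < t) (hε : 0 < ε)
    (hm : 0 < m) (he : e = m * ε) (he1 : 1 / 10 ≤ e) (he2 : e ≤ 1 / 5)
    (hδ : δ = Real.pi / (2 * (m * t))) (hεa : ε < 9 * t / (100 * Real.pi))
    (h : (1 - δ ^ 2) ^ (n * m) ≤ 1 - (1 - 2 * e) ^ 2) :
    32 / 1000 * (t ^ 2 / ε) ≤ n := by
  have hpi := Real.pi_pos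
  have hm' : (0 : ℝ) < m := by exact_mod_cast hm
  have hδ0 : 0 < δ := by rw [hδ]; positivity
  have he0 : 0 < e := by linarith
  -- Here `δ e = π ε / (2 t)`, independent of `m`, so the hypothesis on `ε / t` is exactly a bound
  -- on this product.
  have hδe : δ ≤ 9 / (200 * e) := by
    rw [lt_div_iff₀ (by positivity)] at hεa
    rw [hδ, he, div_le_div_iff₀ (by positivity) (by positivity)]
    nlinarith
  set y := δ ^ 2 with hy
  have hy0 : 0 < y := by positivity
  have hye : y * e ^ 2 ≤ 81 / 40000 := by
    have hp : δ * e ≤ 9 / 200 := by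
      rw [le_div_iff₀ (by positivity)] at hδe
      linarith
    calc y * e ^ 2 = (δ * e) ^ 2 := by rw [hy]; ring
      _ ≤ (9 / 200) ^ 2 := by gcongr
      _ = _ := by norm_num
  have hesq : (1 / 10) ^ 2 ≤ e ^ 2 := by gcongr
  have hy1 : y ≤ 81 / 400 := by
    have := mul_le_mul_of_nonneg_left hesq hy0.le
    linarith
  have hlog := Real.log_le_log (by have : 0 < 1 - y := by linarith
                                   positivity) h
  rw [Real.log_pow] at hlog
  push_cast at hlog
  have hl := le_neg_log_one_sub (x := (1 - 2 * e) ^ 2) (by positivity) (by nlinarith)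
  have hu := neg_log_one_sub_le hy0.le (by linarith)
  have hnm : (0 : ℝ) ≤ n * m := by positivity
  set x := (1 - 2 * e) ^ 2 with hx
  have h1 : x + x ^ 2 / 2 + x ^ 3 / 3 ≤ n * m * (y * (1 - y / 2) / (1 - y)) := by
    have := mul_le_mul_of_nonneg_left hu hnm
    linarith
  have hx0 : 0 ≤ x := by positivity
  -- A rounded tangent line at `x = 49/100`, the value of `x` at the midpoint `e = 3/20` of the
  -- window.
  have hg : 173 / 100 * x - 1986 / 10000 ≤ x + x ^ 2 / 2 + x ^ 3 / 3 := by
    have h2 : 0 ≤ (x - 49 / 100) ^ 2 := sq_nonneg _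
    have h3 : 0 ≤ (x - 49 / 100) ^ 2 * (x + 98 / 100) := by positivity
    linarith
  -- Linear minorant, on the window for `e`, of the resulting cubic in `e`.
  have hline : 977 / 10000 - 71 / 1000 * e ≤ e * (173 / 100 * x - 1986 / 10000) := by
    have h2 : 0 ≤ (e - 1 / 10) * (1 / 5 - e) :=
      mul_nonneg (by linarith) (by linarith)
    have h3 : 0 ≤ (e - 1 / 10) * (1 / 5 - e) * (7 / 10 - e) := mul_nonneg h2 (by linarith)
    rw [hx]
    linarith
  -- The coefficient `1874/100000` is `977/10000 - 7896/100000`. The left side exceeds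
  -- `(7896/100000) (627/1000) (81/40000)`, which bounds the second-order correction in `y` after
  -- multiplication by `e²`.
  have hcube : 1003 / 10000000 ≤ e ^ 2 * (1874 / 100000 - 71 / 1000 * e) := by
    have h2 : 0 ≤ (e - 1 / 10) * (1 / 5 - e) :=
      mul_nonneg (by linarith) (by linarith)
    have h3 : 0 ≤ (e - 1 / 10) * (1 / 5 - e) * e := mul_nonneg h2 he0.le
    linarith
  -- The coefficient `627/1000` is just large enough for `y ≤ 81/400`.
  have hc : y * (1 - y / 2) / (1 - y) ≤ y * (1 + 627 / 1000 * y) := by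
    rw [div_le_iff₀ (by linarith), mul_assoc]
    refine mul_le_mul_of_nonneg_left ?_ hy0.le
    have := mul_le_mul_of_nonneg_left hy1 hy0.le
    linarith
  have hc2 : 1 + 627 / 1000 * y ≤ (977 / 10000 - 71 / 1000 * e) / (7896 / 100000) := by
    rw [le_div_iff₀ (by norm_num)]
    refine le_of_mul_le_mul_left ?_ (by positivity : 0 < e ^ 2)
    linarith
  have hlpos : 0 < 977 / 10000 - 71 / 1000 * e := by linarith
  -- The target `7896/100000` is `(32/1000) (987/100) / 4`, where `987/100` bounds `π²` and `e n m y
  -- = n ε π² / (4 t²)`.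
  have hkey : 7896 / 100000 ≤ e * (n * m * y) := by
    have h4 : 977 / 10000 - 71 / 1000 * e ≤
        e * (n * m * y) * ((977 / 10000 - 71 / 1000 * e) / (7896 / 100000)) := by
      calc 977 / 10000 - 71 / 1000 * e ≤ e * (173 / 100 * x - 1986 / 10000) := hline
        _ ≤ e * (n * m * (y * (1 + 627 / 1000 * y))) := by
            refine mul_le_mul_of_nonneg_left (hg.trans (h1.trans ?_)) he0.le
            exact mul_le_mul_of_nonneg_left hc hnm
        _ = e * (n * m * y) * (1 + 627 / 1000 * y) := by ring
        _ ≤ _ := mul_le_mul_of_nonneg_left hc2 (by positivity)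
    rw [← mul_div_assoc, le_div_iff₀ (by norm_num), mul_comm] at h4
    exact le_of_mul_le_mul_right h4 hlpos
  have hpi2 : Real.pi ^ 2 ≤ 987 / 100 := by
    calc Real.pi ^ 2 ≤ 3.1416 ^ 2 := by gcongr; exact Real.pi_lt_d4.le
      _ ≤ 987 / 100 := by norm_num
  have hval : e * (n * m * y) = n * ε * Real.pi ^ 2 / (4 * t ^ 2) := by
    rw [hy, hδ, he]
    field_simp
    ring
  rw [hval, le_div_iff₀ (by positivity)] at hkey
  rw [← mul_div_assoc, div_le_iff₀ hε]
  have hnε : 0 ≤ n * ε := by positivity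
  have := mul_le_mul_of_nonneg_left hpi2 hnε
  linarith

/-- A number of repetitions that brings the accumulated error into a fixed window. -/
theorem exists_nat_mul_mem_Icc {ε : ℝ} (hε : 0 < ε) (hε1 : ε ≤ 1 / 10) :
    ∃ m : ℕ, 0 < m ∧ 1 / 10 ≤ m * ε ∧ m * ε ≤ 1 / 5 := by
  -- Rounding up overshoots `1/10` by at most `ε ≤ 1/10`.
  refine ⟨⌈1 / 10 / ε⌉₊, Nat.ceil_pos.mpr (by positivity), ?_, ?_⟩
  · rw [← div_le_iff₀ hε]
    exact Nat.le_ceil _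
  · have h := (Nat.ceil_lt_add_one (by positivity : 0 ≤ 1 / 10 / ε)).le
    have h2 := mul_le_mul_of_nonneg_right h hε.le
    rw [add_mul, div_mul_cancel₀ _ hε.ne'] at h2
    linarith
/-! ### A pair of program states supported on two levels -/

/-- The vector with entries `x` and `y` on the first two levels, and zero elsewhere. -/
def twoLevel {d : ℕ} (x y : ℝ) (i : Fin (d + 2)) : ℝ :=
  if i = 0 then x else if i = 1 then y else 0

theorem sum_eq_of_twoLevel {d : ℕ} {M : Type*} [AddCommMonoid M] {g : Fin (d + 2) → M}
    (hg : ∀ i, i ≠ 0 → i ≠ 1 → g i = 0) : ∑ i, g i = g 0 + g 1 := by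
  refine Finset.sum_eq_add (0 : Fin (d + 2)) 1 (by simp) (fun i _ hi => hg i hi.1 hi.2) ?_ ?_ <;>
    simp

/-- Swapping the eigenvalues `(1 ± δ) / 2` gives one-copy overlap `√(1 - δ²)`. The equal
superposition acquires relative phases whose overlap is `cos (m t δ)`, zero by `hphase`. -/
theorem one_sub_sq_pow_le_of_simulates {d n : ℕ} {t ε δ : ℝ} (hε : 0 ≤ ε)
    {P : Matrix (Fin (d + 2) × (Fin n → Fin (d + 2))) (Fin (d + 2) × (Fin n → Fin (d + 2))) ℂ →ₗ[ℂ]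
      Matrix (Fin (d + 2)) (Fin (d + 2)) ℂ} (hP : IsCPTP P) (hsim : Simulates t ε P)
    (hδ0 : 0 ≤ δ) (hδ1 : δ ≤ 1) {m : ℕ} (hm : m * ε ≤ 1 / 2)
    (hphase : m * t * δ = Real.pi / 2) :
    (1 - δ ^ 2) ^ (n * m) ≤ 1 - (1 - 2 * (m * ε)) ^ 2 := by
  set x := Real.sqrt ((1 + δ) / 2) with hx
  set y := Real.sqrt ((1 - δ) / 2) with hy
  set r := Real.sqrt (1 / 2) with hr
  have hx2 : x ^ 2 = (1 + δ) / 2 := Real.sq_sqrt (by linarith)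
  have hy2 : y ^ 2 = (1 - δ) / 2 := Real.sq_sqrt (by linarith)
  have hr2 : r ^ 2 = 1 / 2 := Real.sq_sqrt (by norm_num)
  have hnn : ∀ u v : ℝ, ∑ i, twoLevel (d := d) u v i ^ 2 = u ^ 2 + v ^ 2 := by
    intro u v
    rw [sum_eq_of_twoLevel fun i h0 h1 => by simp [twoLevel, h0, h1]]
    simp [twoLevel]
  have hsum : ∑ i, twoLevel (d := d) x y i * twoLevel (d := d) y x i = 2 * (x * y) := by
    rw [sum_eq_of_twoLevel fun i h0 h1 => by simp [twoLevel, h0, h1]]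
    simp [twoLevel]
    ring
  have h := overlap_pow_le_of_simulates hε hP hsim
    (s := ![twoLevel x y, twoLevel y x]) (c := twoLevel r r) (m := m) ?_ ?_ hm ?_
  · have hsum' : ∑ i, (![twoLevel x y, twoLevel y x] : Fin 2 → Fin (d + 2) → ℝ) 0 i *
        (![twoLevel x y, twoLevel y x] : Fin 2 → Fin (d + 2) → ℝ) 1 i = 2 * (x * y) := hsum
    rw [hsum', ← pow_mul, mul_comm (n * m) 2, pow_mul] at h
    have hval : (2 * (x * y)) ^ 2 = 1 - δ ^ 2 := by
      rw [mul_pow, mul_pow, hx2, hy2]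
      ring
    rwa [hval] at h
  · intro a
    fin_cases a
    · exact (hnn x y).trans (by rw [hx2, hy2]; ring)
    · exact (hnn y x).trans (by rw [hx2, hy2]; ring)
  · rw [hnn, hr2]
    norm_num
  · rw [star_phaseVec_dotProduct, sum_eq_of_twoLevel fun i h0 h1 => by simp [twoLevel, h0, h1]]
    have e0 : ((1 + δ) / 2 - (1 - δ) / 2 : ℂ) = δ := by ring
    have e1 : ((1 - δ) / 2 - (1 + δ) / 2 : ℂ) = -δ := by ring
    have hp : (m * t * δ : ℂ) = Real.pi / 2 := by exact_mod_cast hphase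
    have a0 : Complex.I * ((m * t : ℝ) : ℂ) * (((1 + δ) / 2 : ℝ) - ((1 - δ) / 2 : ℝ) : ℂ) =
        Real.pi / 2 * Complex.I := by
      rw [← hp]; push_cast; ring
    have a1 : Complex.I * ((m * t : ℝ) : ℂ) * (((1 - δ) / 2 : ℝ) - ((1 + δ) / 2 : ℝ) : ℂ) =
        -(Real.pi / 2 * Complex.I) := by
      rw [← hp]; push_cast; ring
    have t0 : ∀ u v : ℝ, twoLevel (d := d) u v 0 = u := fun u v => by simp [twoLevel]
    have t1 : ∀ u v : ℝ, twoLevel (d := d) u v 1 = v := fun u v => by simp [twoLevel]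
    simp only [Matrix.cons_val_zero, Matrix.cons_val_one, t0, t1, hx2, hy2, hr2, a0, a1]
    rw [Complex.exp_neg, Complex.exp_pi_div_two_mul_I, Complex.inv_I]
    ring

end

end SampleSim

theorem theorem2 (t ε : ℝ) (d : ℕ) (ht : 0 ≤ t) (hε : 0 < ε)
    (hεa : ε < min (9 * t / (100 * Real.pi)) (1 / 10)) (hd : 2 ≤ d) :
    ENNReal.ofReal (32 / 1000 * (t ^ 2 / ε)) ≤ (SampleSim.sampleComplexity d t ε : ENNReal) := by
  obtain ⟨d, rfl⟩ := Nat.exists_eq_add_of_le' hd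
  obtain ⟨hε1, hε2⟩ := lt_min_iff.mp hεa
  have hpi := Real.pi_pos
  have ht' : 0 < t := by
    -- At `t = 0` the upper bound on `ε` contradicts `0 < ε`.
    rcases ht.lt_or_eq with h | h
    · exact h
    · rw [← h] at hε1
      simp at hε1
      linarith
  -- The complexity is an extended natural, so the real bound is first rounded up to an integer.
  have hkey : ((⌈32 / 1000 * (t ^ 2 / ε)⌉₊ : ℕ) : ℕ∞) ≤
      SampleSim.sampleComplexity (d + 2) t ε := by
    refine le_iInf₂ fun n hn => ?_
    obtain ⟨P, hP, hsim⟩ := hn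
    rw [Nat.cast_le, Nat.ceil_le]
    obtain ⟨m, hm, hm1, hm2⟩ := SampleSim.exists_nat_mul_mem_Icc hε hε2.le
    have hm' : (0 : ℝ) < m := by exact_mod_cast hm
    -- Needed for `(1 ± δ) / 2` to be eigenvalues of a state: `m ε ≥ 1/10` and the bound on `ε / t`
    -- make `m t` large enough.
    have hδ1 : Real.pi / (2 * (m * t)) ≤ 1 := by
      rw [div_le_one (by positivity)]
      rw [lt_div_iff₀ (by positivity)] at hε1
      have h1 := mul_le_mul_of_nonneg_left hε1.le hm'.le
      have h2 := mul_le_mul_of_nonneg_right hm1 (by positivity : 0 ≤ 100 * Real.pi)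
      linarith [mul_pos hm' ht']
    refine SampleSim.copies_ge_of_overlap_le ht' hε hm rfl hm1 hm2 rfl hε1 ?_
    refine SampleSim.one_sub_sq_pow_le_of_simulates hε.le hP hsim (by positivity) hδ1
      (by linarith) ?_
    field_simp
  calc ENNReal.ofReal (32 / 1000 * (t ^ 2 / ε))
      ≤ ENNReal.ofReal (⌈32 / 1000 * (t ^ 2 / ε)⌉₊ : ℝ) :=
        ENNReal.ofReal_le_ofReal (Nat.le_ceil _)
    _ = (((⌈32 / 1000 * (t ^ 2 / ε)⌉₊ : ℕ) : ℕ∞) : ENNReal) := by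
        rw [ENNReal.ofReal_natCast]; rfl
    _ ≤ _ := ENat.toENNReal_le.mpr hkey
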